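/- A local antimagic labeling of a finite connected simple graph $G=(V,E)$ is a bijection $f:E\to\{1,\dots,|E|\}$ such that $f^+(x)\neq f^+(y)$ for every pair of adjacent vertices $x,y$, where $f^+(x)$ is the sum of $f(e)$ over all edges $e$ incident to $x$. The local antimagic chromatic number $\chi_{la}(G)$ is the minimum, over all local antimagic labelings $f$ of $G$, of the number of distinct values taken by $f^+$. For $r\ge 2$ and integers $a_1\ge a_2\ge\cdots\ge a_r\ge 3$, let $C(a_1,\dots,a_r)$ be the one-point union of $r$ cycles of orders $a_1,\dots,a_r$, that is, the graph obtained from disjoint cycles of these orders by identifying one vertex from each of them to a single vertex. Write $a^{[n]}$ for the sequence $a,\dots,a$ of length $n$. Theorem. Let $G=C(a_1,\dots,a_r)$ with $r\ge 2$ and $a_1\ge\cdots\ge a_r\ge 3$. Then $\chi_{la}(G)=2$ if and only if either $r\ge 3$ and $(a_1,\dots,a_r)=\big((4r-2)^{[r-1]},\,2r-2\big)$, or $r$ is odd and $(a_1,\dots,a_r)=\big((2r)^{[(r-1)/2]},\,(2r-2)^{[(r+1)/2]}\big)$. In all other cases $\chi_{la}(G)=3$. -/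

import Mathlib

namespace LocalAntimagic

/-- The induced label `f⁺(v)`: the sum of `f e` over all edges `e` of `G` incident to `v`. -/
noncomputable def inducedLabel {V : Type*} [Fintype V] (G : SimpleGraph V) (f : Sym2 V → ℕ)
    (v : V) : ℕ :=
  open Classical in ∑ e ∈ Finset.univ.filter (fun e : Sym2 V => e ∈ G.incidenceSet v), f e

/-- `f` restricts to a bijection from the edges of `G` onto `{1, …, |E(G)|}` such that adjacent
vertices receive distinct induced labels. Values of `f` outside the edge set play no role. -/
def IsLocalAntimagicLabeling {V : Type*} [Fintype V] (G : SimpleGraph V) (f : Sym2 V → ℕ) :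
    Prop :=
  Set.BijOn f G.edgeSet (Set.Icc 1 G.edgeSet.ncard) ∧
    ∀ v w : V, G.Adj v w → inducedLabel G f v ≠ inducedLabel G f w

/-- The number `c(f)` of distinct induced labels. -/
noncomputable def colorNumber {V : Type*} [Fintype V] (G : SimpleGraph V) (f : Sym2 V → ℕ) : ℕ :=
  (Set.range (inducedLabel G f)).ncard

/-- The local antimagic chromatic number `χ_la(G)`: the minimum of `c(f)` over all local antimagic
labelings `f` of `G`. (For a nonempty graph without such a labeling the value is the default `0`,
which is never the color number of a labeling.) -/
noncomputable def chiLA {V : Type*} [Fintype V] (G : SimpleGraph V) : ℕ :=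
  sInf {k : ℕ | ∃ f : Sym2 V → ℕ, IsLocalAntimagicLabeling G f ∧ colorNumber G f = k}

/-- Vertices of the one-point union of cycles of orders `a 0, …, a (r - 1)`: `none` is the common
(central) vertex `u`; `some ⟨i, j⟩` is the vertex number `j + 1` on the `i`-th cycle, traversed
starting from `u`, so that the `i`-th cycle is
`u, some ⟨i, 0⟩, some ⟨i, 1⟩, …, some ⟨i, a i - 2⟩, u`. -/
abbrev CycleUnionVertex {r : ℕ} (a : Fin r → ℕ) : Type :=
  Option (Σ i : Fin r, Fin (a i - 1))

/-- Adjacency in the one-point union of cycles: `u` is adjacent to the first and to the last of the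
other vertices on each cycle, and consecutive vertices on the same cycle are adjacent. -/
def cycleUnionAdj {r : ℕ} (a : Fin r → ℕ) : CycleUnionVertex a → CycleUnionVertex a → Prop
  | none, none => False
  | none, some q => q.2.val = 0 ∨ q.2.val + 2 = a q.1
  | some p, none => p.2.val = 0 ∨ p.2.val + 2 = a p.1
  | some p, some q => p.1 = q.1 ∧ (p.2.val + 1 = q.2.val ∨ q.2.val + 1 = p.2.val)

/-- The one-point union `C(a 0, …, a (r - 1))` of cycles of orders `a i ≥ 3`. -/
def cycleUnion {r : ℕ} (a : Fin r → ℕ) : SimpleGraph (CycleUnionVertex a) where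
  Adj := cycleUnionAdj a
  symm := ⟨by
    rintro (_ | p) (_ | q) h
    · exact h
    · exact h
    · exact h
    · exact ⟨h.1.symm, h.2.symm⟩⟩
  loopless := ⟨by
    rintro (_ | p) h
    · exact h
    · rcases h.2 with h | h <;> omega⟩

/-- The nonincreasing sequence `a` is one of the two exceptional sequences
`((4r-2)^{[r-1]}, 2r-2)` with `r ≥ 3`, or `((2r)^{[(r-1)/2]}, (2r-2)^{[(r+1)/2]})` with `r` odd. -/
def IsExceptional {r : ℕ} (a : Fin r → ℕ) : Prop :=
  (3 ≤ r ∧ List.ofFn a = List.replicate (r - 1) (4 * r - 2) ++ [2 * r - 2]) ∨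
  (Odd r ∧ List.ofFn a =
    List.replicate ((r - 1) / 2) (2 * r) ++ List.replicate ((r + 1) / 2) (2 * r - 2))

end LocalAntimagic

/-! Two adjacent vertices already force two colours. For three, traverse the cycles one after
another as a closed Eulerian trail from the centre `u`, labeling its `m` edges `1, m, 2, m - 1, …`.
Non-central vertices then receive `m + 1` or `m + 2`, alternating along each cycle, and `u` receives
more.

With only two colours, `x` at `u` and `y`, the colours alternate along each cycle, so the lengths
are even, say `2 * b i`. Put `M = ∑ b i` and `d = x - y`. Pairing the edges at the vertices of
colour `y` gives `y = 2M + 1`. Along a cycle the labels in even positions form a progression of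
difference `d`, and those in odd positions are its reflection `n ↦ y - n`. The sum at `u` becomes
`d(M + 1) + (2M + 1) = (2M + 1)r + dr`, which forces `d > 2r - 2`. Read in increasing order, these
are `2r` progressions partitioning `{1, …, 2M}`, so every number up to `d` is a starting value and
`d ≤ 2r`. The values `d = 2r - 1` and `d = 2r` give the two exceptional families
(`lengths_of_progressions`, fed by `lengths_of_alternating`). Conversely, for these lengths suitable
starting values make the progressions and their reflections a partition
(`exists_labeling_of_progressions`). -/

namespace LocalAntimagic

/-! ### Invariance under isomorphism -/

section Iso

variable {V W : Type*} [Fintype V] [Fintype W] {G : SimpleGraph V} {H : SimpleGraph W}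

theorem inducedLabel_comp_map (e : G ≃g H) (f : Sym2 W → ℕ) (v : V) :
    inducedLabel G (f ∘ Sym2.map e) v = inducedLabel H f (e v) := by
  classical
  unfold inducedLabel
  have key : ∀ s : Sym2 V, s ∈ G.incidenceSet v ↔ Sym2.map e s ∈ H.incidenceSet (e v) := by
    intro s
    induction s with
    | _ x y => simp [SimpleGraph.incidenceSet, e.map_adj_iff]
  refine Finset.sum_bij (fun s _ => Sym2.map e s) ?_ ?_ ?_ ?_
  · intro s hs
    simpa [← key s] using hs
  · intro s _ t _ h
    exact Sym2.map.injective e.injective h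
  · intro t ht
    have hmap : Sym2.map e (Sym2.map e.symm t) = t := by
      induction t with
      | _ x y => simp
    refine ⟨Sym2.map e.symm t, ?_, hmap⟩
    simp only [Finset.mem_filter, Finset.mem_univ, true_and] at ht ⊢
    rwa [key, hmap]
  · intro s _
    rfl

theorem IsLocalAntimagicLabeling.comp_map (e : G ≃g H) {f : Sym2 W → ℕ}
    (hf : IsLocalAntimagicLabeling H f) : IsLocalAntimagicLabeling G (f ∘ Sym2.map e) := by
  have hb : Set.BijOn (Sym2.map e) G.edgeSet H.edgeSet := by
    refine ⟨?_, (Sym2.map.injective e.injective).injOn, ?_⟩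
    · intro s hs
      induction s with
      | _ x y => simpa [e.map_adj_iff] using hs
    · intro t ht
      induction t with
      | _ x y =>
        refine ⟨s(e.symm x, e.symm y), ?_, by simp⟩
        simpa [e.symm.map_adj_iff] using ht
  refine ⟨?_, ?_⟩
  · have hc : G.edgeSet.ncard = H.edgeSet.ncard := by
      rw [← hb.image_eq, hb.injOn.ncard_image]
    rw [hc]
    exact hf.1.comp hb
  · intro v w h
    rw [inducedLabel_comp_map, inducedLabel_comp_map]
    exact hf.2 _ _ (e.map_adj_iff.2 h)

theorem colorNumber_comp_map (e : G ≃g H) (f : Sym2 W → ℕ) :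
    colorNumber G (f ∘ Sym2.map e) = colorNumber H f := by
  have h : inducedLabel G (f ∘ Sym2.map e) = inducedLabel H f ∘ e :=
    funext fun v => inducedLabel_comp_map e f v
  rw [colorNumber, colorNumber, h, e.surjective.range_comp]

theorem chiLA_eq_of_iso (e : G ≃g H) : chiLA G = chiLA H := by
  unfold chiLA
  congr 1
  ext k
  constructor
  · rintro ⟨f, hf, rfl⟩
    exact ⟨_, hf.comp_map e.symm, colorNumber_comp_map e.symm f⟩
  · rintro ⟨f, hf, rfl⟩
    exact ⟨_, hf.comp_map e, colorNumber_comp_map e f⟩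

theorem two_le_colorNumber {f : Sym2 V → ℕ} (hf : IsLocalAntimagicLabeling G f) {v w : V}
    (h : G.Adj v w) : 2 ≤ colorNumber G f := by
  rw [colorNumber, ← Set.ncard_pair (hf.2 v w h)]
  refine Set.ncard_le_ncard ?_ (Set.finite_range _)
  rintro _ (rfl | rfl) <;> exact ⟨_, rfl⟩

theorem chiLA_le_colorNumber {f : Sym2 V → ℕ} (hf : IsLocalAntimagicLabeling G f) :
    chiLA G ≤ colorNumber G f :=
  Nat.sInf_le ⟨f, hf, rfl⟩

theorem exists_colorNumber_eq_chiLA {f : Sym2 V → ℕ} (hf : IsLocalAntimagicLabeling G f) :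
    ∃ f', IsLocalAntimagicLabeling G f' ∧ colorNumber G f' = chiLA G :=
  Nat.sInf_mem (s := {k | ∃ f, IsLocalAntimagicLabeling G f ∧ colorNumber G f = k}) ⟨_, f, hf, rfl⟩

end Iso

/-! ### Edges and induced labels of a one-point union of cycles -/

section CycleUnion

variable {r : ℕ} (a : Fin r → ℕ)

/-- The `j`-th vertex of the `i`-th closed walk `u, some ⟨i, 0⟩, …, some ⟨i, a i - 2⟩, u`. -/
def cycleVertex (i : Fin r) (j : ℕ) : CycleUnionVertex a :=
  if h : 0 < j ∧ j < a i then some ⟨i, ⟨j - 1, by omega⟩⟩ else none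

/-- The `j`-th edge of the `i`-th cycle. -/
def cycleEdge (i : Fin r) (j : ℕ) : Sym2 (CycleUnionVertex a) :=
  s(cycleVertex a i j, cycleVertex a i (j + 1))

variable {a}

@[simp] theorem cycleVertex_zero (i : Fin r) : cycleVertex a i 0 = none := by
  simp [cycleVertex]

@[simp] theorem cycleVertex_self (i : Fin r) : cycleVertex a i (a i) = none := by
  simp [cycleVertex]

theorem cycleVertex_eq_none_iff {i : Fin r} {j : ℕ} (hj : j ≤ a i) :
    cycleVertex a i j = none ↔ j = 0 ∨ j = a i := by
  unfold cycleVertex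
  split_ifs with h
  · simp; omega
  · simp; omega

theorem cycleVertex_eq_some_iff {i k : Fin r} {j : ℕ} {l : Fin (a k - 1)} :
    cycleVertex a i j = some ⟨k, l⟩ ↔ i = k ∧ j = l + 1 := by
  have hl := l.2
  unfold cycleVertex
  split_ifs with h
  · constructor
    · intro h'
      obtain ⟨rfl, h'⟩ := Sigma.mk.inj_iff.1 (Option.some.inj h')
      rw [heq_eq_eq] at h'
      subst h'
      exact ⟨rfl, by simp; omega⟩
    · rintro ⟨rfl, rfl⟩
      simp
  · constructor
    · intro h'; cases h'
    · rintro ⟨rfl, rfl⟩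
      omega

theorem cycleVertex_succ (i : Fin r) (l : Fin (a i - 1)) :
    cycleVertex a i (l + 1) = some ⟨i, l⟩ :=
  cycleVertex_eq_some_iff.2 ⟨rfl, rfl⟩

theorem none_mem_cycleEdge_iff {i : Fin r} {j : ℕ} (hj : j < a i) :
    none ∈ cycleEdge a i j ↔ j = 0 ∨ j + 1 = a i := by
  rw [cycleEdge, Sym2.mem_iff, eq_comm, cycleVertex_eq_none_iff hj.le, eq_comm (a := none),
    cycleVertex_eq_none_iff hj]
  omega

theorem some_mem_cycleEdge_iff {i k : Fin r} {j : ℕ} {l : Fin (a k - 1)} :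
    some ⟨k, l⟩ ∈ cycleEdge a i j ↔ i = k ∧ (j = l ∨ j = l + 1) := by
  rw [cycleEdge, Sym2.mem_iff, eq_comm, cycleVertex_eq_some_iff, eq_comm (b := cycleVertex _ _ _),
    cycleVertex_eq_some_iff]
  omega

theorem adj_cycleVertex (ha : ∀ i, 3 ≤ a i) {i : Fin r} {j : ℕ} (hj : j < a i) :
    (cycleUnion a).Adj (cycleVertex a i j) (cycleVertex a i (j + 1)) := by
  have := ha i
  change cycleUnionAdj a _ _
  unfold cycleVertex
  split_ifs with h1 h2 h2
  · refine ⟨rfl, ?_⟩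
    simp; omega
  · simp only [cycleUnionAdj]; omega
  · simp only [cycleUnionAdj]; omega
  · omega

theorem exists_cycleEdge_of_adj (ha : ∀ i, 3 ≤ a i) {v w : CycleUnionVertex a}
    (h : (cycleUnion a).Adj v w) : ∃ i, ∃ j < a i, s(v, w) = cycleEdge a i j := by
  have key : ∀ q : Σ i : Fin r, Fin (a i - 1), q.2.val = 0 ∨ q.2.val + 2 = a q.1 →
      ∃ i, ∃ j < a i, s(none, some q) = cycleEdge a i j := by
    rintro ⟨i, l⟩ (h | h)
    · refine ⟨i, 0, by have := ha i; omega, ?_⟩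
      have h1 := cycleVertex_succ i l
      simp only at h
      rw [h] at h1
      rw [cycleEdge, h1, cycleVertex_zero]
    · simp only at h
      refine ⟨i, l + 1, by omega, ?_⟩
      rw [cycleEdge, cycleVertex_succ, Sym2.eq_swap, show l.val + 1 + 1 = a i by omega,
        cycleVertex_self]
  have key' : ∀ i : Fin r, ∀ k l : Fin (a i - 1), k.val + 1 = l.val →
      ∃ i', ∃ j < a i', s(some ⟨i, k⟩, some ⟨i, l⟩) = cycleEdge a i' j := by
    intro i k l h
    refine ⟨i, k + 1, by omega, ?_⟩
    rw [cycleEdge, cycleVertex_succ, h, cycleVertex_succ]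
  rcases v with _ | ⟨i, k⟩ <;> rcases w with _ | ⟨i', l⟩
  · exact h.elim
  · exact key _ h
  · rw [Sym2.eq_swap]
    exact key _ h
  · obtain ⟨h1, h2⟩ := h
    simp only at h1
    subst h1
    rcases h2 with h2 | h2
    · exact key' _ _ _ h2
    · rw [Sym2.eq_swap]
      exact key' _ _ _ h2

/-- An edge is recovered from the vertices it contains. As the orders are at least 3, every edge has
a non-central end, which fixes the cycle; membership of the vertices of that cycle then fixes the
position. -/
theorem cycleEdge_injective (ha : ∀ i, 3 ≤ a i) :
    Function.Injective fun p : Σ i, Fin (a i) => cycleEdge a p.1 p.2 := by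
  rintro ⟨i, j⟩ ⟨i', j'⟩ h
  simp only at h
  have hai := ha i
  have hai' := ha i'
  have hj := j.2
  have hj' := j'.2
  have h0 := none_mem_cycleEdge_iff hj
  have h0' := none_mem_cycleEdge_iff hj'
  have h1 := fun l : Fin (a i - 1) => some_mem_cycleEdge_iff (i := i) (k := i) (j := j) (l := l)
  have h1' := fun l : Fin (a i - 1) => some_mem_cycleEdge_iff (i := i') (k := i) (j := j') (l := l)
  simp only [← h] at h0' h1'
  have h2 := fun l => (h1 l).symm.trans (h1' l)
  have h3 := h0.symm.trans h0'
  have hii : i' = i := by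
    by_cases hz : j.val = 0
    · exact ((h2 ⟨0, by omega⟩).1 ⟨rfl, by simp [hz]⟩).1
    · exact ((h2 ⟨j - 1, by omega⟩).1 ⟨rfl, by simp; omega⟩).1
  subst hii
  have h4 : j = j' := by
    ext
    by_cases hz : j.val = 0
    · have := ((h2 ⟨0, by omega⟩).1 ⟨rfl, by simp [hz]⟩).2
      simp only at this
      omega
    · by_cases hz' : j'.val = 0
      · have := ((h2 ⟨0, by omega⟩).2 ⟨rfl, by simp [hz']⟩).2
        simp only at this
        omega
      · have e1 := ((h2 ⟨j - 1, by omega⟩).1 ⟨rfl, by simp; omega⟩).2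
        have e2 := ((h2 ⟨j' - 1, by omega⟩).2 ⟨rfl, by simp; omega⟩).2
        simp only at e1 e2
        omega
  rw [h4]

theorem edgeSet_cycleUnion (ha : ∀ i, 3 ≤ a i) :
    (cycleUnion a).edgeSet = Set.range fun p : Σ i, Fin (a i) => cycleEdge a p.1 p.2 := by
  ext e
  constructor
  · induction e with
    | _ v w =>
      intro h
      obtain ⟨i, j, hj, he⟩ := exists_cycleEdge_of_adj ha h
      exact ⟨⟨i, ⟨j, hj⟩⟩, he.symm⟩
  · rintro ⟨⟨i, j⟩, rfl⟩
    exact adj_cycleVertex ha j.2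

theorem ncard_edgeSet_cycleUnion (ha : ∀ i, 3 ≤ a i) :
    (cycleUnion a).edgeSet.ncard = ∑ i, a i := by
  rw [edgeSet_cycleUnion ha, ← Set.image_univ,
    Set.ncard_image_of_injective _ (cycleEdge_injective ha), Set.ncard_univ]
  simp [Nat.card_eq_fintype_card]

theorem inducedLabel_cycleUnion (ha : ∀ i, 3 ≤ a i) (f : Sym2 (CycleUnionVertex a) → ℕ)
    (v : CycleUnionVertex a) :
    open Classical in inducedLabel (cycleUnion a) f v =
      ∑ i, ∑ j ∈ Finset.range (a i), if v ∈ cycleEdge a i j then f (cycleEdge a i j) else 0 := by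
  classical
  have h1 : ∀ i, (∑ j ∈ Finset.range (a i),
      if v ∈ cycleEdge a i j then f (cycleEdge a i j) else 0) =
      ∑ j : Fin (a i), if v ∈ cycleEdge a i j then f (cycleEdge a i j) else 0 := fun i =>
    Finset.sum_range _
  simp only [h1]
  rw [← Fintype.sum_sigma' (fun (i : Fin r) (j : Fin (a i)) =>
    if v ∈ cycleEdge a i j then f (cycleEdge a i j) else 0), ← Finset.sum_filter, inducedLabel]
  symm
  refine Finset.sum_bij (fun p _ => cycleEdge a p.1 p.2) ?_ ?_ ?_ ?_
  · intro p hp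
    simp only [Finset.mem_filter, Finset.mem_univ, true_and] at hp ⊢
    exact ⟨edgeSet_cycleUnion ha ▸ ⟨p, rfl⟩, hp⟩
  · intro p _ q _ h
    exact cycleEdge_injective ha h
  · intro e he
    simp only [Finset.mem_filter, Finset.mem_univ, true_and] at he
    obtain ⟨h2, h3⟩ := he
    rw [edgeSet_cycleUnion ha] at h2
    obtain ⟨p, rfl⟩ := h2
    exact ⟨p, by simpa using h3, rfl⟩
  · intro p _
    rfl

theorem inducedLabel_none (ha : ∀ i, 3 ≤ a i) (f : Sym2 (CycleUnionVertex a) → ℕ) :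
    inducedLabel (cycleUnion a) f none =
      ∑ i, (f (cycleEdge a i 0) + f (cycleEdge a i (a i - 1))) := by
  classical
  rw [inducedLabel_cycleUnion ha]
  refine Finset.sum_congr rfl fun i _ => ?_
  have hi := ha i
  rw [← Finset.sum_filter, ← Finset.sum_pair (f := fun j => f (cycleEdge a i j))
    (show 0 ≠ a i - 1 by omega)]
  refine Finset.sum_congr ?_ fun _ _ => rfl
  ext j
  simp only [Finset.mem_filter, Finset.mem_range, Finset.mem_insert, Finset.mem_singleton]
  constructor
  · rintro ⟨h1, h2⟩
    rw [none_mem_cycleEdge_iff h1] at h2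
    omega
  · intro h
    have h1 : j < a i := by omega
    refine ⟨h1, ?_⟩
    rw [none_mem_cycleEdge_iff h1]
    omega

theorem inducedLabel_cycleVertex (ha : ∀ i, 3 ≤ a i) (f : Sym2 (CycleUnionVertex a) → ℕ)
    {i : Fin r} {j : ℕ} (hj : j + 1 < a i) :
    inducedLabel (cycleUnion a) f (cycleVertex a i (j + 1)) =
      f (cycleEdge a i j) + f (cycleEdge a i (j + 1)) := by
  classical
  have hv : cycleVertex a i (j + 1) = some ⟨i, ⟨j, by omega⟩⟩ :=
    cycleVertex_eq_some_iff.2 ⟨rfl, rfl⟩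
  rw [inducedLabel_cycleUnion ha, hv, Finset.sum_eq_single i]
  · rw [← Finset.sum_filter, ← Finset.sum_pair (f := fun j => f (cycleEdge a i j))
      (show j ≠ j + 1 by omega)]
    refine Finset.sum_congr ?_ fun _ _ => rfl
    ext k
    simp only [Finset.mem_filter, Finset.mem_range, Finset.mem_insert, Finset.mem_singleton,
      some_mem_cycleEdge_iff, true_and]
    omega
  · intro k _ hk
    refine Finset.sum_eq_zero fun j _ => ?_
    rw [if_neg]
    rw [some_mem_cycleEdge_iff]
    exact fun h => hk h.1
  · simp

theorem bijOn_edgeSet_iff (ha : ∀ i, 3 ≤ a i) (f : Sym2 (CycleUnionVertex a) → ℕ) :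
    Set.BijOn f (cycleUnion a).edgeSet (Set.Icc 1 (cycleUnion a).edgeSet.ncard) ↔
      Set.BijOn (fun p : Σ i, Fin (a i) => f (cycleEdge a p.1 p.2)) Set.univ
        (Set.Icc 1 (∑ i, a i)) := by
  rw [ncard_edgeSet_cycleUnion ha, edgeSet_cycleUnion ha]
  rw [← Set.image_univ]
  exact (Set.bijOn_comp_iff (cycleEdge_injective ha).injOn).symm

/-- Every labeling of the edge positions of the cycles with the required properties comes from a
local antimagic labeling of the one-point union. -/
theorem exists_labeling (ha : ∀ i, 3 ≤ a i) (g : Fin r → ℕ → ℕ) (c : ℕ)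
    (hinj : ∀ i j i' j', j < a i → j' < a i' → g i j = g i' j' → i = i' ∧ j = j')
    (hpos : ∀ i, ∀ j < a i, 1 ≤ g i j) (hle : ∀ i, ∀ j < a i, g i j ≤ ∑ i, a i)
    (hc : ∑ i, (g i 0 + g i (a i - 1)) = c)
    (hne : ∀ i j, j + 1 < a i → j = 0 ∨ j + 2 = a i → g i j + g i (j + 1) ≠ c)
    (hadj : ∀ i j, j + 2 < a i → g i j ≠ g i (j + 2)) :
    ∃ f, IsLocalAntimagicLabeling (cycleUnion a) f ∧
      ∀ v, inducedLabel (cycleUnion a) f v = c ∨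
        ∃ i j, j + 1 < a i ∧ inducedLabel (cycleUnion a) f v = g i j + g i (j + 1) := by
  classical
  set φ := fun p : Σ i, Fin (a i) => cycleEdge a p.1 p.2 with hφ
  obtain ⟨f, hf⟩ : ∃ f : Sym2 (CycleUnionVertex a) → ℕ,
      ∀ i j, j < a i → f (cycleEdge a i j) = g i j := by
    -- The value 0 off the edge set is arbitrary.
    refine ⟨Function.extend φ (fun p => g p.1 p.2) 0, fun i j hj => ?_⟩
    exact (cycleEdge_injective ha).extend_apply (fun p : Σ i, Fin (a i) => g p.1 p.2) 0
      ⟨i, ⟨j, hj⟩⟩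
  have hnone : inducedLabel (cycleUnion a) f none = c := by
    rw [inducedLabel_none ha, ← hc]
    refine Finset.sum_congr rfl fun i _ => ?_
    have := ha i
    rw [hf i 0 (by omega), hf i (a i - 1) (by omega)]
  have hsome : ∀ i j, j + 1 < a i →
      inducedLabel (cycleUnion a) f (cycleVertex a i (j + 1)) = g i j + g i (j + 1) := by
    intro i j hj
    rw [inducedLabel_cycleVertex ha f hj, hf i j (by omega), hf i (j + 1) hj]
  have hstep : ∀ i j, j < a i → inducedLabel (cycleUnion a) f (cycleVertex a i j) ≠
      inducedLabel (cycleUnion a) f (cycleVertex a i (j + 1)) := by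
    intro i j hj
    have hi := ha i
    rcases j with _ | j
    · rw [cycleVertex_zero, hnone, hsome i 0 (by omega)]
      exact (hne i 0 (by omega) (Or.inl rfl)).symm
    · rw [hsome i j hj]
      by_cases h : j + 2 = a i
      · rw [show j + 1 + 1 = a i by omega, cycleVertex_self, hnone]
        exact hne i j hj (Or.inr h)
      · rw [hsome i (j + 1) (by omega)]
        -- The two vertices share the edge in position `j + 1`, so their sums differ exactly when
        -- the outer labels do.
        have := hadj i j (by omega)
        rw [show j + 1 + 1 = j + 2 by omega]
        omega
  refine ⟨f, ⟨?_, ?_⟩, ?_⟩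
  · rw [bijOn_edgeSet_iff ha]
    have hmaps : Set.MapsTo (fun p : Σ i, Fin (a i) => f (cycleEdge a p.1 p.2)) Set.univ
        (Set.Icc 1 (∑ i, a i)) := by
      rintro ⟨i, j⟩ _
      simp only [hf i j j.2]
      exact ⟨hpos i j j.2, hle i j j.2⟩
    have hinj' : Function.Injective (fun p : Σ i, Fin (a i) => f (cycleEdge a p.1 p.2)) := by
      rintro ⟨i, j⟩ ⟨i', j'⟩ h
      simp only [hf i j j.2, hf i' j' j'.2] at h
      obtain ⟨rfl, h⟩ := hinj i j i' j' j.2 j'.2 h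
      rw [Fin.ext h]
    refine ⟨hmaps, hinj'.injOn, ?_⟩
    -- Injectivity suffices: the number of edges equals the number of available labels.
    have him : (fun p : Σ i, Fin (a i) => f (cycleEdge a p.1 p.2)) '' Set.univ =
        Set.Icc 1 (∑ i, a i) := by
      refine Set.eq_of_subset_of_ncard_le hmaps.image_subset ?_ (Set.finite_Icc _ _)
      rw [Set.ncard_image_of_injective _ hinj', Set.ncard_univ]
      simp [Nat.card_eq_fintype_card, Set.ncard_eq_toFinset_card']
    exact him.symm.subset
  · intro v w h
    obtain ⟨i, j, hj, he⟩ := exists_cycleEdge_of_adj ha h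
    rcases Sym2.eq_iff.1 he with ⟨rfl, rfl⟩ | ⟨rfl, rfl⟩
    · exact hstep i j hj
    · exact (hstep i j hj).symm
  · rintro (_ | ⟨i, l⟩)
    · exact Or.inl hnone
    · refine Or.inr ⟨i, l, by omega, ?_⟩
      rw [← cycleVertex_succ, hsome i l (by omega)]

end CycleUnion

end LocalAntimagic

/-! ### Labelings with three colours and with two colours -/

namespace LocalAntimagic

/-- The labels `1, m, 2, m - 1, 3, …` of the successive edges of a trail with `m` edges. -/
def trailLabel (m n : ℕ) : ℕ := if n % 2 = 0 then n / 2 + 1 else m - n / 2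

theorem trailLabel_pos {m n : ℕ} (h : n < m) : 1 ≤ trailLabel m n := by
  unfold trailLabel; split_ifs <;> omega

theorem trailLabel_le {m n : ℕ} (h : n < m) : trailLabel m n ≤ m := by
  unfold trailLabel; split_ifs <;> omega

theorem trailLabel_inj {m n k : ℕ} (hn : n < m) (hk : k < m)
    (h : trailLabel m n = trailLabel m k) : n = k := by
  unfold trailLabel at h; split_ifs at h <;> omega

theorem trailLabel_add_succ {m n : ℕ} (h : n + 1 < m) :
    trailLabel m n + trailLabel m (n + 1) = m + 1 ∨
      trailLabel m n + trailLabel m (n + 1) = m + 2 := by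
  unfold trailLabel; split_ifs <;> omega

theorem trailLabel_ne_add_two {m n : ℕ} (h : n + 2 < m) :
    trailLabel m n ≠ trailLabel m (n + 2) := fun he => by
  have := trailLabel_inj (by omega) h he
  omega

variable {r : ℕ} {a : Fin r → ℕ}

theorem exists_labeling_colorNumber_le_three (hr : 2 ≤ r) (ha : ∀ i, 3 ≤ a i) :
    ∃ f, IsLocalAntimagicLabeling (cycleUnion a) f ∧ colorNumber (cycleUnion a) f ≤ 3 := by
  set m := ∑ i, a i with hm
  -- `P i` is the offset of the `i`-th cycle when the cycles are concatenated into one closed trail.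
  obtain ⟨P, hlt, hinj, h0, h1⟩ : ∃ P : Fin r → ℕ, (∀ i, ∀ j < a i, P i + j < m) ∧
      (∀ i j i' j', j < a i → j' < a i' → P i + j = P i' + j' → i = i' ∧ j = j') ∧
      P ⟨0, by omega⟩ = 0 ∧ P ⟨1, by omega⟩ = a ⟨0, by omega⟩ := by
    have key : ∀ i j (hj : j < a i), (finSigmaFinEquiv (⟨i, ⟨j, hj⟩⟩ : Σ i, Fin (a i)) : ℕ) =
        ∑ k : Fin i.1, a (Fin.castLE i.2.le k) + j := fun i j hj => finSigmaFinEquiv_apply _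
    refine ⟨fun i => ∑ k : Fin i.1, a (Fin.castLE i.2.le k), ?_, ?_, ?_, ?_⟩
    · intro i j hj
      rw [← key i j hj]
      exact Fin.is_lt _
    · intro i j i' j' hj hj' h
      rw [← key i j hj, ← key i' j' hj'] at h
      have := finSigmaFinEquiv.injective (Fin.ext h)
      obtain ⟨rfl, h2⟩ := Sigma.mk.inj_iff.1 this
      exact ⟨rfl, congrArg Fin.val (eq_of_heq h2)⟩
    · simp
    · simp only [Fin.sum_univ_one]
      rfl
  obtain ⟨c, hc⟩ : ∃ c, ∑ i, (trailLabel m (P i + 0) + trailLabel m (P i + (a i - 1))) = c :=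
    ⟨_, rfl⟩
  -- At `u`, the last edge of cycle 0 and the first edge of cycle 1 are consecutive on the trail and
  -- contribute at least `m + 1`. The other two edges of these cycles at `u` contribute at least 1
  -- each.
  have hcm : m + 2 < ∑ i, (trailLabel m (P i + 0) + trailLabel m (P i + (a i - 1))) := by
    have hne : (⟨0, by omega⟩ : Fin r) ≠ ⟨1, by omega⟩ := by simp
    have hsub := Finset.sum_le_sum_of_subset
      (f := fun i => trailLabel m (P i + 0) + trailLabel m (P i + (a i - 1)))
      (Finset.subset_univ {(⟨0, by omega⟩ : Fin r), ⟨1, by omega⟩})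
    rw [Finset.sum_pair hne, h0, h1] at hsub
    have ha0 := ha ⟨0, by omega⟩
    have ha1 := ha ⟨1, by omega⟩
    have hm1 := hlt ⟨1, by omega⟩ 0 (by omega)
    have hm2 := hlt ⟨1, by omega⟩ (a ⟨1, by omega⟩ - 1) (by omega)
    rw [h1] at hm1 hm2
    have e1 := trailLabel_add_succ (m := m) (n := 0 + (a ⟨0, by omega⟩ - 1)) (by omega)
    rw [show 0 + (a ⟨0, by omega⟩ - 1) + 1 = a ⟨0, by omega⟩ + 0 by omega] at e1
    have e2 := trailLabel_pos (m := m) (n := 0 + 0) (by omega)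
    have e3 := trailLabel_pos hm2
    omega
  rw [hc] at hcm
  refine (exists_labeling ha (fun i j => trailLabel m (P i + j)) c ?_ ?_ ?_ hc
    ?_ ?_).imp fun f ⟨hf, hcol⟩ => ⟨hf, ?_⟩
  · intro i j i' j' hj hj' h
    exact hinj i j i' j' hj hj' (trailLabel_inj (hlt i j hj) (hlt i' j' hj') h)
  · exact fun i j hj => trailLabel_pos (hlt i j hj)
  · exact fun i j hj => trailLabel_le (hlt i j hj)
  · intro i j hj _
    have : trailLabel m (P i + j) + trailLabel m (P i + (j + 1)) = m + 1 ∨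
        trailLabel m (P i + j) + trailLabel m (P i + (j + 1)) = m + 2 :=
      trailLabel_add_succ (hlt i (j + 1) hj)
    omega
  · exact fun i j hj => trailLabel_ne_add_two (hlt i (j + 2) hj)
  · refine (Set.ncard_le_ncard (t := {c, m + 1, m + 2}) ?_ (by simp)).trans
      ((Set.ncard_insert_le _ _).trans (Nat.succ_le_succ ((Set.ncard_insert_le _ _).trans (by simp))))
    rintro _ ⟨v, rfl⟩
    rcases hcol v with h | ⟨i, j, hj, h⟩
    · exact Or.inl h
    · rw [h]
      exact Or.inr (trailLabel_add_succ (hlt i (j + 1) hj))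

/-- Arithmetic progressions with common difference `d` which, together with their reflections,
partition `{1, …, 2M}` give a local antimagic labeling with two colors. -/
theorem exists_labeling_of_progressions (b s : Fin r → ℕ) (d M : ℕ) (hM : ∑ i, b i = M)
    (hd : 0 < d) (hb : ∀ i, 2 ≤ b i) (ha : ∀ i, a i = 2 * b i) (hs : Function.Injective s)
    (hpos : ∀ i, 1 ≤ s i) (hsd : ∀ i, s i ≤ d) (htop : ∀ i, s i + d * (b i - 1) ≤ 2 * M)
    (hrefl : ∀ i j t t', t < b i → t' < b j → s i + s j + d * (t + t') ≠ 2 * M + 1)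
    (hcenter : d * (M + 1) + (2 * M + 1) = (2 * M + 1) * r + d * r) :
    ∃ f, IsLocalAntimagicLabeling (cycleUnion a) f ∧ colorNumber (cycleUnion a) f ≤ 2 := by
  -- Even positions carry the progression, odd positions its reflection. Consecutive sums are then
  -- alternately `2 * M + 1` and `2 * M + 1 + d`, and the latter is also the sum at the centre.
  obtain ⟨g, hg0, hg1⟩ : ∃ g : Fin r → ℕ → ℕ, (∀ i t, g i (2 * t) = s i + d * t) ∧
      (∀ i t, g i (2 * t + 1) = 2 * M + 1 - (s i + d * t)) := by
    refine ⟨fun i j => if j % 2 = 0 then s i + d * (j / 2) else 2 * M + 1 - (s i + d * (j / 2)),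
      fun i t => ?_, fun i t => ?_⟩
    · simp
    · have h1 : (2 * t + 1) % 2 = 1 := by omega
      have h2 : (2 * t + 1) / 2 = t := by omega
      simp [h1, h2]
  have hsum : ∑ i, a i = 2 * M := by
    rw [← hM, Finset.mul_sum]
    exact Finset.sum_congr rfl fun i _ => ha i
  have hle : ∀ i, ∀ t < b i, s i + d * t ≤ 2 * M := fun i t ht =>
    (Nat.add_le_add_left (Nat.mul_le_mul_left d (by omega)) _).trans (htop i)
  -- Since `1 ≤ s i ≤ d`, this is uniqueness of division by `d`, with remainders in `{1, …, d}`.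
  have hinj : ∀ i t i' t', s i + d * t = s i' + d * t' → i = i' ∧ t = t' := by
    have aux : ∀ i t i' t', s i + d * t = s i' + d * t' → t ≤ t' := by
      intro i t i' t' h
      by_contra hlt
      have h1 : d * (t' + 1) ≤ d * t := Nat.mul_le_mul_left d (by omega)
      have := hpos i
      have := hsd i'
      rw [mul_add] at h1
      omega
    intro i t i' t' h
    have ht := le_antisymm (aux _ _ _ _ h) (aux _ _ _ _ h.symm)
    subst ht
    exact ⟨hs (by omega), rfl⟩
  have hparity : ∀ j, ∃ t, j = 2 * t ∨ j = 2 * t + 1 := fun j => ⟨j / 2, by omega⟩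
  have hcross : ∀ i t i' t', t < b i → t' < b i' →
      s i + d * t ≠ 2 * M + 1 - (s i' + d * t') := by
    intro i t i' t' ht ht' h
    refine hrefl i i' t t' ht ht' ?_
    have := hle i' t' ht'
    rw [mul_add]
    omega
  have hlow : ∀ i, ∀ t < b i, g i (2 * t) + g i (2 * t + 1) = 2 * M + 1 := by
    intro i t ht
    rw [hg0, hg1]
    have := hle i t ht
    omega
  have hhigh : ∀ i t, t + 1 < b i → g i (2 * t + 1) + g i (2 * t + 2) = 2 * M + 1 + d := by
    intro i t ht
    rw [hg1, show 2 * t + 2 = 2 * (t + 1) by ring, hg0]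
    have := hle i t (by omega)
    rw [mul_add]
    omega
  refine (exists_labeling (a := a) (fun i => by have := hb i; have := ha i; omega)
    g (2 * M + 1 + d) ?_ ?_ ?_ ?_ ?_ ?_).imp fun f ⟨hf, hcol⟩ => ⟨hf, ?_⟩
  · intro i j i' j' hj hj' h
    have hai := ha i
    have hai' := ha i'
    obtain ⟨t, rfl | rfl⟩ := hparity j <;> obtain ⟨t', rfl | rfl⟩ := hparity j' <;>
      simp only [hg0, hg1] at h
    · obtain ⟨h1, h2⟩ := hinj _ _ _ _ h
      exact ⟨h1, by omega⟩
    · exact absurd h (hcross _ _ _ _ (by omega) (by omega))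
    · exact absurd h.symm (hcross _ _ _ _ (by omega) (by omega))
    · have e1 := hle i t (by omega)
      have e2 := hle i' t' (by omega)
      obtain ⟨h1, h2⟩ := hinj i t i' t' (by omega)
      exact ⟨h1, by omega⟩
  · intro i j hj
    have hai := ha i
    obtain ⟨t, rfl | rfl⟩ := hparity j
    · rw [hg0]
      have := hpos i
      omega
    · rw [hg1]
      have := hle i t (by omega)
      omega
  · intro i j hj
    have hai := ha i
    rw [hsum]
    obtain ⟨t, rfl | rfl⟩ := hparity j
    · rw [hg0]
      exact hle i t (by omega)
    · rw [hg1]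
      have := hpos i
      omega
  · have e1 : ∑ i, (g i 0 + g i (a i - 1)) + ∑ i, d * (b i - 1) = r * (2 * M + 1) := by
      rw [← Finset.sum_add_distrib]
      have : ∀ i ∈ Finset.univ, g i 0 + g i (a i - 1) + d * (b i - 1) = 2 * M + 1 := by
        intro i _
        have h0 := hg0 i 0
        have h1 := hg1 i (b i - 1)
        have h2 := hle i (b i - 1) (by have := hb i; omega)
        rw [show 2 * (b i - 1) + 1 = a i - 1 by have := hb i; have := ha i; omega] at h1
        rw [h1]
        simp only [mul_zero, add_zero] at h0
        rw [h0]
        omega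
      rw [Finset.sum_congr rfl this]
      simp
    have e2 : ∑ i, d * (b i - 1) + d * r = d * M := by
      rw [← Finset.mul_sum, ← mul_add, ← hM]
      congr 1
      calc ∑ i, (b i - 1) + r = ∑ i, ((b i - 1) + 1) := by simp [Finset.sum_add_distrib]
        _ = ∑ i, b i := Finset.sum_congr rfl fun i _ => by have := hb i; omega
    nlinarith
  · intro i j hj h
    have hai := ha i
    -- The neighbours of the centre sit between an even and an odd position, because `a i` is even;
    -- their colour is `2 * M + 1`.
    have : ∃ t, j = 2 * t := ⟨j / 2, by omega⟩
    obtain ⟨t, rfl⟩ := this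
    rw [hlow i t (by omega)]
    omega
  · intro i j hj h
    have hai := ha i
    obtain ⟨t, rfl | rfl⟩ := hparity j
    · rw [show 2 * t + 2 = 2 * (t + 1) by ring, hg0, hg0] at h
      have := (hinj _ _ _ _ h).2
      omega
    · rw [show 2 * t + 1 + 2 = 2 * (t + 1) + 1 by ring, hg1, hg1] at h
      have e1 := hle i t (by omega)
      have e2 := hle i (t + 1) (by omega)
      have := (hinj i t i (t + 1) (by omega)).2
      omega
  · refine (Set.ncard_le_ncard (t := {2 * M + 1 + d, 2 * M + 1}) ?_ (by simp)).trans
      ((Set.ncard_insert_le _ _).trans (by simp))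
    rintro _ ⟨v, rfl⟩
    rcases hcol v with h | ⟨i, j, hj, h⟩
    · exact Or.inl h
    · rw [h]
      have hai := ha i
      obtain ⟨t, rfl | rfl⟩ := hparity j
      · exact Or.inr (hlow i t (by omega))
      · exact Or.inl (hhigh i t (by omega))

/-- `r - 1` cycles of order `4r - 2` and one of order `2r - 2`. -/
theorem exists_labeling_of_lengths (hr : 3 ≤ r)
    (h : ∀ i : Fin r, a i = if i.1 < r - 1 then 4 * r - 2 else 2 * r - 2) :
    ∃ f, IsLocalAntimagicLabeling (cycleUnion a) f ∧ colorNumber (cycleUnion a) f ≤ 2 := by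
  obtain ⟨k, rfl⟩ : ∃ k, r = k + 1 := ⟨r - 1, by omega⟩
  have hk : 2 ≤ k := by omega
  simp only [Nat.add_sub_cancel] at h
  -- Here `d = 2 * k + 1` and `2 * M + 1 = d ^ 2`, so reflection negates residues modulo `d`. The
  -- long progressions take the residues `1, …, k` and reflect to the remaining nonzero ones; the
  -- short one consists of the first half of the multiples of `d` below `d ^ 2`.
  refine exists_labeling_of_progressions (fun i => if i.1 < k then 2 * k + 1 else k)
    (fun i => if i.1 < k then i.1 + 1 else 2 * k + 1) (2 * k + 1) (2 * k * (k + 1))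
    ?_ (by omega) ?_ ?_ ?_ ?_ ?_ ?_ ?_ ?_
  · rw [Fin.sum_univ_castSucc]
    simp
    ring
  · intro i; split_ifs <;> omega
  · intro i; rw [h]; split_ifs <;> omega
  · intro i j hij; dsimp only at hij; ext; split_ifs at hij <;> omega
  · intro i; split_ifs <;> omega
  · intro i; split_ifs <;> omega
  · intro i
    split_ifs
    · rw [Nat.add_sub_cancel]
      nlinarith
    · obtain ⟨l, rfl⟩ : ∃ l, k = l + 1 := ⟨k - 1, by omega⟩
      rw [Nat.add_sub_cancel]
      nlinarith
  · intro i j t t' ht ht' he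
    rw [show 2 * (2 * k * (k + 1)) + 1 = (2 * k + 1) * (2 * k + 1) by ring] at he
    have hdvd : (2 * k + 1) ∣ (if i.1 < k then i.1 + 1 else 2 * k + 1) +
        (if j.1 < k then j.1 + 1 else 2 * k + 1) :=
      (Nat.dvd_add_left (Dvd.intro _ rfl)).1 (he ▸ Dvd.intro _ rfl)
    split_ifs at hdvd he ht ht'
    · have := Nat.le_of_dvd (by omega) hdvd
      omega
    · have := Nat.le_of_dvd (by omega) ((Nat.dvd_add_left (dvd_refl _)).1 hdvd)
      omega
    · have := Nat.le_of_dvd (by omega) ((Nat.dvd_add_right (dvd_refl _)).1 hdvd)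
      omega
    · have h2 : (2 * k + 1) * (2 + (t + t')) = (2 * k + 1) * (2 * k + 1) := by
        rw [← he]; ring
      have := Nat.eq_of_mul_eq_mul_left (by omega) h2
      omega
  · ring

/-- For `r = 2h + 1`, there are `h` cycles of order `2r` and `h + 1` of order `2r - 2`. -/
theorem exists_labeling_of_odd (hr : 2 ≤ r) (hodd : Odd r)
    (h : ∀ i : Fin r, a i = if i.1 < (r - 1) / 2 then 2 * r else 2 * r - 2) :
    ∃ f, IsLocalAntimagicLabeling (cycleUnion a) f ∧ colorNumber (cycleUnion a) f ≤ 2 := by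
  obtain ⟨k, rfl⟩ := hodd
  have hk : 1 ≤ k := by omega
  rw [show (2 * k + 1 - 1) / 2 = k by omega] at h
  -- Here `d = 2 * (2 * k + 1)` and `2 * M + 1 = 2 * k + 1 + d * (2 * k)`, so reflection sends a
  -- residue `n` to `2 * k + 1 - n` modulo `d`. It maps `1, …, k` onto `k + 1, …, 2 * k`, and `2 * k
  -- + 1, …, 3 * k + 1` onto `3 * k + 2, …, d`.
  refine exists_labeling_of_progressions (fun i => if i.1 < k then 2 * k + 1 else 2 * k)
    (fun i => if i.1 < k then i.1 + 1 else i.1 + k + 1) (2 * (2 * k + 1)) (k * (4 * k + 3))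
    ?_ (by omega) ?_ ?_ ?_ ?_ ?_ ?_ ?_ ?_
  · have e : ∀ i : Fin (2 * k + 1), (if i.1 < k then 2 * k + 1 else 2 * k) =
        2 * k + if i.1 < k then 1 else 0 := fun i => by split_ifs <;> omega
    have e2 : (∑ i : Fin (2 * k + 1), if i.1 < k then 1 else 0) = k := by
      rw [Finset.sum_boole]
      have := Fin.card_filter_val_lt (n := 2 * k + 1) (m := k)
      simp at this ⊢
      omega
    rw [Finset.sum_congr rfl fun i _ => e i, Finset.sum_add_distrib, e2]
    simp
    ring
  · intro i; split_ifs <;> omega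
  · intro i; rw [h]; split_ifs <;> omega
  · intro i j hij; dsimp only at hij; ext; split_ifs at hij <;> omega
  · intro i; split_ifs <;> omega
  · intro i; split_ifs <;> omega
  · intro i
    have := i.2
    split_ifs
    · rw [Nat.add_sub_cancel]
      nlinarith
    · obtain ⟨l, rfl⟩ : ∃ l, k = l + 1 := ⟨k - 1, by omega⟩
      rw [show 2 * (l + 1) - 1 = 2 * l + 1 by omega]
      nlinarith
  · intro i j t t' ht ht' he
    have hi := i.2
    have hj := j.2
    rw [show 2 * (k * (4 * k + 3)) + 1 = 2 * k + 1 + 2 * (2 * k + 1) * (2 * k) by ring] at he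
    have hmod := congrArg (· % (2 * (2 * k + 1))) he
    simp only [Nat.add_mul_mod_self_left] at hmod
    rw [Nat.mod_eq_of_lt (show 2 * k + 1 < 2 * (2 * k + 1) by omega)] at hmod
    split_ifs at hmod
    · rw [Nat.mod_eq_of_lt (by omega)] at hmod
      omega
    · by_cases hlt : i.1 + 1 + (j.1 + k + 1) < 2 * (2 * k + 1)
      · rw [Nat.mod_eq_of_lt hlt] at hmod
        omega
      · rw [Nat.mod_eq_sub_mod (by omega), Nat.mod_eq_of_lt (by omega)] at hmod
        omega
    · by_cases hlt : i.1 + k + 1 + (j.1 + 1) < 2 * (2 * k + 1)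
      · rw [Nat.mod_eq_of_lt hlt] at hmod
        omega
      · rw [Nat.mod_eq_sub_mod (by omega), Nat.mod_eq_of_lt (by omega)] at hmod
        omega
    · by_cases hlt : i.1 + k + 1 + (j.1 + k + 1) < 2 * (2 * k + 1)
      · rw [Nat.mod_eq_of_lt hlt] at hmod
        omega
      · rw [Nat.mod_eq_sub_mod (by omega), Nat.mod_eq_of_lt (by omega)] at hmod
        omega
  · ring

end LocalAntimagic

/-! ### Necessity: the lengths forced by two colours -/

namespace LocalAntimagic

theorem sum_Icc_two_mul (M : ℕ) : ∑ n ∈ Finset.Icc 1 (2 * M), n = M * (2 * M + 1) := by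
  induction M with
  | zero => simp
  | succ M ih =>
    rw [show 2 * (M + 1) = 2 * M + 1 + 1 by ring, Finset.sum_Icc_succ_top (by omega),
      Finset.sum_Icc_succ_top (by omega), ih]
    ring

theorem sum_range_two_mul {h : ℕ → ℕ} {y : ℕ} (b : ℕ)
    (hy : ∀ t < b, h (2 * t) + h (2 * t + 1) = y) : ∑ j ∈ Finset.range (2 * b), h j = b * y := by
  induction b with
  | zero => simp
  | succ b ih =>
    rw [show 2 * (b + 1) = 2 * b + 1 + 1 by ring, Finset.sum_range_succ, Finset.sum_range_succ,
      ih fun t ht => hy t (by omega), add_assoc, hy b (by omega)]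
    ring

variable {r : ℕ}

/-- Progressions of difference `d` and lengths `b i` starting at `s i`, whose reflections start
at `l i`, such that every number up to `d` is a starting value. -/
theorem lengths_of_progressions (hr : 2 ≤ r) (b s l : Fin r → ℕ) (d M : ℕ) (hM : ∑ i, b i = M)
    (hb : ∀ i, 2 ≤ b i) (hcenter : d * (M + 1) + (2 * M + 1) = (2 * M + 1) * r + d * r)
    (hs : ∀ i, 1 ≤ s i) (hl : ∀ i, 1 ≤ l i)
    (hsum : ∀ i, s i + l i + d * (b i - 1) = 2 * M + 1)
    (hinj : Function.Injective (Sum.elim s l))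
    (hcov : ∀ n, 1 ≤ n → n ≤ d → n ≤ 2 * M → ∃ q, Sum.elim s l q = n) :
    (3 ≤ r ∧ ∃ i₀, b i₀ = r - 1 ∧ ∀ i, i ≠ i₀ → b i = 2 * r - 1) ∨
      (Odd r ∧ (∀ i, b i = r ∨ b i = r - 1) ∧ ∑ i, b i = r * (r - 1) + (r - 1) / 2) := by
  classical
  obtain ⟨k, rfl⟩ : ∃ k, r = k + 1 := ⟨r - 1, by omega⟩
  have hk : 1 ≤ k := by omega
  simp only [Nat.add_sub_cancel]
  have hMr : 2 * (k + 1) ≤ M := by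
    have := Finset.card_nsmul_le_sum Finset.univ b 2 fun i _ => hb i
    rw [hM] at this
    simp at this
    omega
  obtain ⟨N, rfl⟩ : ∃ N, M = N + k := ⟨M - k, by omega⟩
  have hN : k + 2 ≤ N := by omega
  -- The centre equation with `k = r - 1` and `N = M - r + 1`. Its last term is positive, which
  -- forces `d > 2 * k`.
  have hc : d * N = 2 * k * N + k * (2 * k + 1) := by nlinarith
  have hd : 2 * k < d := by
    by_contra hle
    have : d * N ≤ 2 * k * N := Nat.mul_le_mul_right N (by omega)
    nlinarith
  -- The minimum is needed because `d ≤ 2 * M` is not yet known; it follows once these numbers are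
  -- counted against the `2 * (k + 1)` starting values.
  have himg : Finset.Icc 1 (min d (2 * (N + k))) ⊆ Finset.univ.image (Sum.elim s l) := by
    intro n hn
    rw [Finset.mem_Icc, le_min_iff] at hn
    obtain ⟨q, hq⟩ := hcov n hn.1 hn.2.1 hn.2.2
    exact Finset.mem_image.2 ⟨q, Finset.mem_univ _, hq⟩
  have hcard : (Finset.univ.image (Sum.elim s l)).card = 2 * (k + 1) := by
    rw [Finset.card_image_of_injective _ hinj]
    simp
    ring
  have hd2 : d ≤ 2 * (k + 1) := by
    have := Finset.card_le_card himg
    rw [hcard, Nat.card_Icc] at this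
    omega
  rw [show min d (2 * (N + k)) = d by omega] at himg
  obtain rfl | rfl : d = 2 * k + 1 ∨ d = 2 * (k + 1) := by omega
  · left
    have hNk : N = k * (2 * k + 1) := by nlinarith
    subst hNk
    have hsq : 2 * (k * (2 * k + 1) + k) + 1 = (2 * k + 1) * (2 * k + 1) := by ring
    rw [hsq] at hsum
    -- The `2 * k + 2` starting values cover `1, …, d` with one value `L` to spare; `i₀` will be the
    -- cycle on which `L` occurs.
    have hone : (Finset.univ.image (Sum.elim s l) \ Finset.Icc 1 (2 * k + 1)).card = 1 := by
      rw [Finset.card_sdiff_of_subset himg, hcard, Nat.card_Icc]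
      omega
    obtain ⟨L, hL⟩ := Finset.card_eq_one.1 hone
    have hbig : ∀ q, 2 * k + 1 < Sum.elim s l q → Sum.elim s l q = L := by
      intro q hq
      have : Sum.elim s l q ∈ Finset.univ.image (Sum.elim s l) \ Finset.Icc 1 (2 * k + 1) := by
        rw [Finset.mem_sdiff, Finset.mem_Icc]
        exact ⟨Finset.mem_image_of_mem _ (Finset.mem_univ _), by omega⟩
      rw [hL] at this
      exact Finset.mem_singleton.1 this
    obtain ⟨i₀, hi₀⟩ : ∃ i₀, ∀ i, i ≠ i₀ → s i ≤ 2 * k + 1 ∧ l i ≤ 2 * k + 1 := by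
      have hLm : L ∈ Finset.univ.image (Sum.elim s l) \ Finset.Icc 1 (2 * k + 1) := by
        rw [hL]; exact Finset.mem_singleton_self _
      obtain ⟨q, -, hq⟩ := Finset.mem_image.1 (Finset.mem_sdiff.1 hLm).1
      refine ⟨Sum.elim id id q, fun i hi => ⟨?_, ?_⟩⟩
      · by_contra hlt
        have h1 := hinj ((hbig (Sum.inl i) (by simpa using hlt)).trans hq.symm)
        exact hi (by rw [← h1]; rfl)
      · by_contra hlt
        have h1 := hinj ((hbig (Sum.inr i) (by simpa using hlt)).trans hq.symm)
        exact hi (by rw [← h1]; rfl)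
    have hlen : ∀ i, i ≠ i₀ → b i = 2 * k + 1 := by
      intro i hi
      obtain ⟨h1, h2⟩ := hi₀ i hi
      have h3 := hs i
      have h4 := hl i
      have h5 : s i ≠ l i := fun h => by
        have := @hinj (Sum.inl i) (Sum.inr i) h
        simp at this
      -- As `2 * M + 1 = d ^ 2`, the sum `s i + l i` is a multiple of `d`. It is positive and, for
      -- distinct values up to `d`, less than `2 * d`; hence it equals `d`.
      have h6 : (2 * k + 1) ∣ s i + l i :=
        (Nat.dvd_add_left (Dvd.intro _ rfl)).1 (hsum i ▸ Dvd.intro _ rfl)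
      obtain ⟨c, hc⟩ := h6
      have hc1 : c = 1 := by
        have : c ≠ 0 := by rintro rfl; omega
        have : c < 2 := by
          by_contra hge
          have := Nat.mul_le_mul_left (2 * k + 1) (not_lt.1 hge)
          omega
        omega
      have h7 := hsum i
      rw [hc, hc1, ← mul_add] at h7
      have := Nat.eq_of_mul_eq_mul_left (by omega) h7
      have := hb i
      omega
    have hb0 : b i₀ = k := by
      rw [← Finset.add_sum_erase _ _ (Finset.mem_univ i₀),
        Finset.sum_congr rfl fun i hi => hlen i (Finset.ne_of_mem_erase hi)] at hM
      simp at hM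
      nlinarith
    refine ⟨?_, i₀, hb0, fun i hi => ?_⟩
    · have := hb i₀
      omega
    · rw [hlen i hi]
      omega
  · right
    have hNk : 2 * N = k * (2 * k + 1) := by nlinarith
    -- The factor `2 * k + 1` is odd, so `k` is even and `r = k + 1` is odd.
    obtain ⟨h, rfl⟩ : ∃ h, k = 2 * h := by
      rcases Nat.even_or_odd k with ⟨h, hh⟩ | ⟨h, hh⟩
      · exact ⟨h, by omega⟩
      · exfalso
        have := congrArg (· % 2) hNk
        simp [Nat.mul_mod, hh] at this
    have hNk' : N = h * (4 * h + 1) := by nlinarith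
    subst hNk'
    have himg' : Finset.univ.image (Sum.elim s l) = Finset.Icc 1 (2 * (2 * h + 1)) := by
      refine (Finset.eq_of_subset_of_card_le himg ?_).symm
      rw [hcard, Nat.card_Icc]
      omega
    have hle : ∀ q, Sum.elim s l q ≤ 2 * (2 * h + 1) := fun q => by
      have := Finset.mem_image_of_mem (Sum.elim s l) (Finset.mem_univ q)
      rw [himg', Finset.mem_Icc] at this
      exact this.2
    refine ⟨⟨h, rfl⟩, fun i => ?_, ?_⟩
    · have h1 := hle (Sum.inl i)
      have h2 := hle (Sum.inr i)
      simp only [Sum.elim_inl, Sum.elim_inr] at h1 h2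
      have h3 := hs i
      have h4 := hl i
      have h5 := hsum i
      obtain ⟨c, hc⟩ : ∃ c, b i = c + 1 := ⟨b i - 1, by have := hb i; omega⟩
      -- Here `2 * M + 1 = d * (2 * h) + (2 * h + 1)` with `d = 2 * (2 * h + 1)`. The bounds `0 < s
      -- i + l i ≤ 2 * d` leave only `c = 2 * h - 1` and `c = 2 * h`.
      rw [hc, Nat.add_sub_cancel] at h5
      have h6 : c ≤ 2 * h := by
        by_contra hlt
        have := Nat.mul_le_mul_left (2 * (2 * h + 1)) (show 2 * h + 1 ≤ c by omega)
        nlinarith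
      have h7 : 2 * h ≤ c + 1 := by
        by_contra hlt
        have := Nat.mul_le_mul_left (2 * (2 * h + 1)) (show c + 2 ≤ 2 * h by omega)
        nlinarith
      omega
    · rw [hM, show 2 * h / 2 = h by omega]
      ring

/-- The lengths of the cycles in a labeling with induced labels `x`, `y` that alternate. -/
theorem lengths_of_alternating (hr : 2 ≤ r) (b : Fin r → ℕ) (hb : ∀ i, 2 ≤ b i)
    (g : Fin r → ℕ → ℕ) (x y : ℕ) (hy : ∀ i, ∀ t < b i, g i (2 * t) + g i (2 * t + 1) = y)
    (hx : ∀ i t, t + 1 < b i → g i (2 * t + 1) + g i (2 * t + 2) = x)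
    (hc : ∑ i, (g i 0 + g i (2 * b i - 1)) = x)
    (hbij : Set.BijOn (fun p : Σ i, Fin (2 * b i) => g p.1 p.2) Set.univ
      (Set.Icc 1 (2 * ∑ i, b i))) :
    (3 ≤ r ∧ ∃ i₀, b i₀ = r - 1 ∧ ∀ i, i ≠ i₀ → b i = 2 * r - 1) ∨
      (Odd r ∧ (∀ i, b i = r ∨ b i = r - 1) ∧ ∑ i, b i = r * (r - 1) + (r - 1) / 2) := by
  classical
  obtain ⟨M, hM⟩ : ∃ M, ∑ i, b i = M := ⟨_, rfl⟩
  rw [hM] at hbij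
  have hMr : 2 * r ≤ M := by
    have := Finset.card_nsmul_le_sum Finset.univ b 2 fun i _ => hb i
    rw [hM] at this
    simp at this
    omega
  have hinj : ∀ i j i' j', j < 2 * b i → j' < 2 * b i' → g i j = g i' j' → i = i' ∧ j = j' := by
    intro i j i' j' hj hj' h
    have := hbij.injOn (Set.mem_univ ⟨i, ⟨j, hj⟩⟩) (Set.mem_univ ⟨i', ⟨j', hj'⟩⟩) h
    obtain ⟨rfl, h2⟩ := Sigma.mk.inj_iff.1 this
    exact ⟨rfl, congrArg Fin.val (eq_of_heq h2)⟩
  have hrange : ∀ i, ∀ j < 2 * b i, 1 ≤ g i j ∧ g i j ≤ 2 * M := fun i j hj =>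
    Set.mem_Icc.1 (hbij.mapsTo (Set.mem_univ (⟨i, ⟨j, hj⟩⟩ : Σ i, Fin (2 * b i))))
  have hsurj : ∀ n, 1 ≤ n → n ≤ 2 * M → ∃ i, ∃ j < 2 * b i, g i j = n := by
    intro n h1 h2
    obtain ⟨⟨i, j⟩, -, h⟩ := hbij.surjOn ⟨h1, h2⟩
    exact ⟨i, j, j.2, h⟩
  have hyM : y = 2 * M + 1 := by
    have e1 : ∑ p : Σ i, Fin (2 * b i), g p.1 p.2 = M * (2 * M + 1) := by
      rw [← sum_Icc_two_mul]
      refine Finset.sum_bij (fun p _ => g p.1 p.2) ?_ ?_ ?_ ?_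
      · intro p _
        exact Finset.mem_Icc.2 (hrange p.1 p.2 p.2.2)
      · intro p _ q _ h
        exact hbij.injOn (Set.mem_univ p) (Set.mem_univ q) h
      · intro n hn
        obtain ⟨p, -, h⟩ := hbij.surjOn (Set.mem_Icc.2 (Finset.mem_Icc.1 hn))
        exact ⟨p, Finset.mem_univ _, h⟩
      · intro p _
        rfl
    have e2 : ∑ p : Σ i, Fin (2 * b i), g p.1 p.2 = M * y := by
      rw [Fintype.sum_sigma, ← hM, Finset.sum_mul]
      refine Finset.sum_congr rfl fun i _ => ?_
      rw [← sum_range_two_mul (b i) (hy i), Finset.sum_range]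
    exact Nat.eq_of_mul_eq_mul_left (by omega) (e2.symm.trans e1)
  -- The computation runs in `ℤ` because the sign of `x - y` is settled only by the centre equation.
  have hodd : ∀ i, ∀ t < b i, (g i (2 * t + 1) : ℤ) = y - g i (2 * t) := by
    intro i t ht
    have := hy i t ht
    omega
  have heven : ∀ i, ∀ t < b i, (g i (2 * t) : ℤ) = g i 0 + ((x : ℤ) - y) * t := by
    intro i t
    induction t with
    | zero => simp
    | succ t ih =>
      intro ht
      have h1 := ih (by omega)
      have h2 := hodd i t (by omega)
      have h3 := hx i t ht
      rw [show 2 * (t + 1) = 2 * t + 2 by ring]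
      push_cast
      rw [mul_add]
      omega
  have hlast : ∀ i, (g i (2 * b i - 1) : ℤ) = y - g i 0 - ((x : ℤ) - y) * (b i - 1) := by
    intro i
    have hi := hb i
    have h1 := heven i (b i - 1) (by omega)
    have h2 := hodd i (b i - 1) (by omega)
    rw [show 2 * (b i - 1) + 1 = 2 * b i - 1 by omega] at h2
    rw [h2, h1]
    push_cast [Nat.cast_sub (show 1 ≤ b i by omega)]
    ring
  have hcen : (x : ℤ) = r * y - ((x : ℤ) - y) * (M - r) := by
    have h1 : ((∑ i, (g i 0 + g i (2 * b i - 1)) : ℕ) : ℤ) =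
        ∑ i, ((y : ℤ) - ((x : ℤ) - y) * (b i - 1)) := by
      push_cast
      refine Finset.sum_congr rfl fun i _ => ?_
      rw [hlast i]
      ring
    rw [hc, Finset.sum_sub_distrib, ← Finset.mul_sum, Finset.sum_sub_distrib] at h1
    simp only [Finset.sum_const, Finset.card_univ, Fintype.card_fin, nsmul_eq_mul, mul_one] at h1
    push_cast [← hM]
    exact h1
  have hxy : y < x := by
    by_contra hle
    -- The centre equation rearranged: the right side is positive and so is `M - r + 1`, hence `x >
    -- y`.
    have h1 : ((x : ℤ) - y) * (M - r + 1) = (r - 1) * y := by linarith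
    have h2 : (0 : ℤ) < (r - 1) * y := by
      refine mul_pos ?_ ?_ <;> omega
    have h3 : ((x : ℤ) - y) * (M - r + 1) ≤ 0 :=
      mul_nonpos_of_nonpos_of_nonneg (by omega) (by omega)
    omega
  obtain ⟨d, rfl⟩ : ∃ d, x = y + d := ⟨x - y, by omega⟩
  simp only [Nat.cast_add, add_sub_cancel_left] at heven hlast hcen
  have heven' : ∀ i, ∀ t < b i, g i (2 * t) = g i 0 + d * t := fun i t ht => by
    have := heven i t ht
    exact_mod_cast this
  have hlast' : ∀ i, g i 0 + g i (2 * b i - 1) + d * (b i - 1) = 2 * M + 1 := fun i => by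
    have h1 := hlast i
    have hi := hb i
    rw [← hyM]
    zify [show 1 ≤ b i by omega]
    linarith
  have hodd' : ∀ i, ∀ t < b i, g i (2 * t + 1) = g i (2 * b i - 1) + d * (b i - 1 - t) := by
    intro i t ht
    have h1 := hy i t ht
    rw [heven' i t ht] at h1
    have h2 := hlast' i
    have h3 : d * (b i - 1) = d * t + d * (b i - 1 - t) := by
      rw [← mul_add]
      congr 1
      omega
    omega
  refine lengths_of_progressions hr b (fun i => g i 0) (fun i => g i (2 * b i - 1)) d M hM hb
    ?_ ?_ ?_ hlast' ?_ ?_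
  · subst hyM
    zify
    push_cast at hcen
    linarith
  · exact fun i => (hrange i 0 (by have := hb i; omega)).1
  · exact fun i => (hrange i _ (by have := hb i; omega)).1
  · rintro (i | i) (i' | i') h <;> simp only [Sum.elim_inl, Sum.elim_inr] at h
    all_goals
      have hi := hb i
      have hi' := hb i'
      obtain ⟨rfl, h⟩ := hinj _ _ _ _ (by omega) (by omega) h
      first | rfl | omega
  · intro n h1 h2 h3
    obtain ⟨i, j, hj, rfl⟩ := hsurj n h1 h3
    have hi := hb i
    -- A term beyond the start of its progression exceeds `d`, so a label at most `d` is a starting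
    -- value.
    have aux : ∀ u t, 1 ≤ u → u + d * t ≤ d → t = 0 := by
      intro u t hu h
      by_contra ht
      have := Nat.mul_le_mul_left d (Nat.one_le_iff_ne_zero.2 ht)
      omega
    rcases Nat.even_or_odd' j with ⟨t, rfl | rfl⟩
    · refine ⟨Sum.inl i, ?_⟩
      rw [heven' i t (by omega)] at h2 ⊢
      rw [aux _ _ (hrange i 0 (by omega)).1 h2]
      simp
    · refine ⟨Sum.inr i, ?_⟩
      rw [hodd' i t (by omega)] at h2 ⊢
      rw [aux _ _ (hrange i _ (by omega)).1 h2]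
      simp

end LocalAntimagic

/-! ### From lengths to exceptional sequences, and the conclusion -/

namespace LocalAntimagic

variable {r : ℕ} {a : Fin r → ℕ}

theorem ofFn_eq_replicate_append_iff {p q A B : ℕ} (hpq : p + q = r) :
    List.ofFn a = List.replicate p A ++ List.replicate q B ↔
      ∀ i : Fin r, a i = if i.1 < p then A else B := by
  have hget : ∀ (n : ℕ) (h : n < (List.replicate p A ++ List.replicate q B).length),
      (List.replicate p A ++ List.replicate q B)[n] = if n < p then A else B := by
    intro n h
    rw [List.getElem_append]
    simp
  constructor
  · intro h i
    have h1 : (List.ofFn a)[i.1]'(by simp) = a i := by simp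
    rw [← h1, ← hget i.1 (by simp; omega)]
    congr 1
  · intro h
    refine List.ext_getElem (by simp; omega) fun n h1 h2 => ?_
    rw [hget, List.getElem_ofFn, h]

theorem isExceptional_iff (hr : 2 ≤ r) : IsExceptional a ↔
    (3 ≤ r ∧ ∀ i : Fin r, a i = if i.1 < r - 1 then 4 * r - 2 else 2 * r - 2) ∨
      (Odd r ∧ ∀ i : Fin r, a i = if i.1 < (r - 1) / 2 then 2 * r else 2 * r - 2) := by
  unfold IsExceptional
  rw [show [2 * r - 2] = List.replicate 1 (2 * r - 2) from rfl,
    ofFn_eq_replicate_append_iff (by omega)]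
  refine or_congr Iff.rfl (and_congr_right ?_)
  rintro ⟨k, hk⟩
  rw [ofFn_eq_replicate_append_iff (by omega)]

/-- By monotonicity the indices with the larger value form an initial segment, so their number
determines the sequence. -/
theorem _root_.Antitone.eq_ite_of_card {A B p : ℕ} (ha : Antitone a) (hAB : B < A)
    (hval : ∀ i, a i = A ∨ a i = B) (hcard : (Finset.univ.filter fun i => a i = A).card = p)
    (i : Fin r) : a i = if i.1 < p then A else B := by
  split_ifs with h
  · by_contra hne
    have hsub : (Finset.univ.filter fun i => a i = A) ⊆ Finset.Iio i := by
      intro j hj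
      rw [Finset.mem_filter] at hj
      rw [Finset.mem_Iio]
      by_contra hle
      have := ha (not_lt.1 hle)
      have := (hval i).resolve_left hne
      omega
    have := Finset.card_le_card hsub
    rw [hcard, Fin.card_Iio] at this
    omega
  · refine (hval i).resolve_left fun heq => ?_
    have hsub : Finset.Iic i ⊆ Finset.univ.filter fun i => a i = A := by
      intro j hj
      rw [Finset.mem_Iic] at hj
      rw [Finset.mem_filter]
      have := ha hj
      refine ⟨Finset.mem_univ _, (hval j).resolve_right ?_⟩
      omega
    have := Finset.card_le_card hsub
    rw [hcard, Fin.card_Iic] at this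
    omega

/-- A labeling with two colors alternates along the cycles, which have even lengths. -/
theorem exists_alternating (ha : ∀ i, 3 ≤ a i) {f : Sym2 (CycleUnionVertex a) → ℕ}
    (hf : IsLocalAntimagicLabeling (cycleUnion a) f) (h2 : colorNumber (cycleUnion a) f = 2) :
    ∃ x y, x ≠ y ∧ inducedLabel (cycleUnion a) f none = x ∧ ∀ i, ∀ j ≤ a i,
      inducedLabel (cycleUnion a) f (cycleVertex a i j) = if j % 2 = 0 then x else y := by
  obtain ⟨p, q, hpq, hrange⟩ := Set.ncard_eq_two.1 h2
  obtain ⟨x, y, hxy, hx, hor⟩ : ∃ x y, x ≠ y ∧ inducedLabel (cycleUnion a) f none = x ∧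
      ∀ v, inducedLabel (cycleUnion a) f v = x ∨ inducedLabel (cycleUnion a) f v = y := by
    have hmem : ∀ v, inducedLabel (cycleUnion a) f v = p ∨ inducedLabel (cycleUnion a) f v = q :=
      fun v => by
        have := Set.mem_range_self (f := inducedLabel (cycleUnion a) f) v
        rwa [hrange] at this
    rcases hmem none with h | h
    · exact ⟨p, q, hpq, h, hmem⟩
    · exact ⟨q, p, hpq.symm, h, fun v => (hmem v).symm⟩
  refine ⟨x, y, hxy, hx, fun i j => ?_⟩
  induction j with
  | zero => intro _; simpa using hx
  | succ j ih =>
    intro hj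
    have h1 := hf.2 _ _ (adj_cycleVertex ha (show j < a i by omega))
    rw [ih (by omega)] at h1
    have h3 := hor (cycleVertex a i (j + 1))
    split_ifs at h1 ⊢ with h4 h5 h5
    · omega
    · exact h3.resolve_right (Ne.symm h1)
    · exact h3.resolve_left (Ne.symm h1)
    · omega

theorem isExceptional_of_colorNumber_eq_two (hr : 2 ≤ r) (hanti : Antitone a)
    (ha : ∀ i, 3 ≤ a i) {f : Sym2 (CycleUnionVertex a) → ℕ}
    (hf : IsLocalAntimagicLabeling (cycleUnion a) f) (h2 : colorNumber (cycleUnion a) f = 2) :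
    IsExceptional a := by
  classical
  obtain ⟨x, y, hxy, hx, hcol⟩ := exists_alternating ha hf h2
  obtain ⟨b, hb⟩ : ∃ b : Fin r → ℕ, ∀ i, a i = 2 * b i := by
    refine ⟨fun i => a i / 2, fun i => ?_⟩
    -- Position `a i` is the centre again, with label `x`, so `a i` is even.
    have h := hcol i (a i) le_rfl
    rw [cycleVertex_self, hx] at h
    dsimp only
    split_ifs at h with h1
    · omega
    · exact absurd h hxy
  obtain rfl : a = fun i => 2 * b i := funext hb
  have hb2 : ∀ i, 2 ≤ b i := fun i => by have := ha i; dsimp only at this; omega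
  have hbij := (bijOn_edgeSet_iff ha f).1 hf.1
  rw [← Finset.mul_sum] at hbij
  have hlab : ∀ i j, j + 1 < 2 * b i → f (cycleEdge _ i j) + f (cycleEdge _ i (j + 1)) =
      if (j + 1) % 2 = 0 then x else y := fun i j hj => by
    rw [← inducedLabel_cycleVertex ha f hj, hcol i (j + 1) hj.le]
  rw [isExceptional_iff hr]
  rcases lengths_of_alternating hr b hb2 (fun i j => f (cycleEdge _ i j)) x y
    (fun i t ht => (hlab i (2 * t) (by omega)).trans (if_neg (by omega)))
    (fun i t ht => (hlab i (2 * t + 1) (by omega)).trans (if_pos (by omega)))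
    (by rw [← hx, inducedLabel_none ha]) hbij with ⟨h3, i₀, h0, hi⟩ | ⟨hodd, hval, hsum⟩
  · refine Or.inl ⟨h3, hanti.eq_ite_of_card (by omega) (fun i => ?_) ?_⟩
    · by_cases h : i = i₀
      · subst h
        right
        omega
      · left
        have := hi i h
        omega
    · have : (Finset.univ.filter fun i => 2 * b i = 4 * r - 2) = Finset.univ.erase i₀ := by
        ext i
        rw [Finset.mem_filter, Finset.mem_erase]
        by_cases h : i = i₀
        · subst h
          simp
          omega
        · have := hi i h
          simp [h]
          omega
      rw [this, Finset.card_erase_of_mem (Finset.mem_univ _)]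
      simp
  · refine Or.inr ⟨hodd, hanti.eq_ite_of_card (by omega) (fun i => ?_) ?_⟩
    · have := hval i
      omega
    · have e : ∀ i, b i = (r - 1) + if 2 * b i = 2 * r then 1 else 0 := fun i => by
        have := hval i
        split_ifs <;> omega
      rw [Finset.sum_congr rfl fun i _ => e i, Finset.sum_add_distrib, Finset.sum_boole] at hsum
      simp only [Finset.sum_const, Finset.card_univ, Fintype.card_fin, smul_eq_mul,
        Nat.cast_id] at hsum
      omega

theorem exists_labeling_of_isExceptional (hr : 2 ≤ r) (h : IsExceptional a) :
    ∃ f, IsLocalAntimagicLabeling (cycleUnion a) f ∧ colorNumber (cycleUnion a) f ≤ 2 := by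
  rcases (isExceptional_iff hr).1 h with ⟨h3, h⟩ | ⟨hodd, h⟩
  · exact exists_labeling_of_lengths h3 h
  · exact exists_labeling_of_odd hr hodd h

theorem chiLA_cycleUnion (hr : 2 ≤ r) (ha : Antitone a) (ha3 : ∀ i, 3 ≤ a i) :
    (chiLA (cycleUnion a) = 2 ↔ IsExceptional a) ∧
      (¬ IsExceptional a → chiLA (cycleUnion a) = 3) := by
  obtain ⟨f, hf, hf3⟩ := exists_labeling_colorNumber_le_three hr ha3
  obtain ⟨f', hf', hchi⟩ := exists_colorNumber_eq_chiLA hf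
  have hle : chiLA (cycleUnion a) ≤ 3 := (chiLA_le_colorNumber hf).trans hf3
  have hge : 2 ≤ chiLA (cycleUnion a) := by
    rw [← hchi]
    exact two_le_colorNumber hf' (adj_cycleVertex ha3 (i := ⟨0, by omega⟩) (j := 0)
      (by have := ha3 ⟨0, by omega⟩; omega))
  have hiff : chiLA (cycleUnion a) = 2 ↔ IsExceptional a := by
    constructor
    · intro h
      exact isExceptional_of_colorNumber_eq_two hr ha ha3 hf' (hchi.trans h)
    · intro h
      obtain ⟨f₂, hf₂, h2⟩ := exists_labeling_of_isExceptional hr h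
      exact le_antisymm ((chiLA_le_colorNumber hf₂).trans h2) hge
  refine ⟨hiff, fun h => ?_⟩
  rw [← hiff] at h
  omega

end LocalAntimagic

theorem mainTheorem1 {V : Type*} [Fintype V] (G : SimpleGraph V)
    (r : ℕ) (hr : 2 ≤ r) (a : Fin r → ℕ) (ha : Antitone a) (ha3 : ∀ i, 3 ≤ a i)
    (hG : Nonempty (G ≃g LocalAntimagic.cycleUnion a)) :
    (LocalAntimagic.chiLA G = 2 ↔ LocalAntimagic.IsExceptional a) ∧
      (¬ LocalAntimagic.IsExceptional a → LocalAntimagic.chiLA G = 3) := by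
  obtain ⟨e⟩ := hG
  rw [LocalAntimagic.chiLA_eq_of_iso e]
  exact LocalAntimagic.chiLA_cycleUnion hr ha ha3
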